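/- For a finite graph $G$ let $\rho(G)$ denote the largest eigenvalue of its adjacency matrix. Let $\nabla$ denote the join and $\cup$ the disjoint union of graphs, and let $mK_1$ be the graph with $m$ vertices and no edges. A graph $G$ is called $k$-extendable if it contains a matching with $k$ edges and every matching with $k$ edges is contained in a perfect matching of $G$. **Theorem 1.1.** Let $k\ge 1$ be an integer and let $G$ be a connected finite simple graph of even order $n$ with minimum degree $\delta\ge 2k$, where $n\ge \max\{8\delta-10k+4,\ \delta(\delta-2k)^2+\delta-1\}$. If $$\rho(G)\ \ge\ \rho\bigl(K_\delta\nabla(K_{n-2\delta+2k-1}\cup(\delta-2k+1)K_1)\bigr),$$ then $G$ is $k$-extendable, unless $G\cong K_\delta\nabla(K_{n-2\delta+2k-1}\cup(\delta-2k+1)K_1)$, in which case $G$ is not $k$-extendable. -/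

import Mathlib

namespace SimpleGraph

/-- The spectral radius `ρ(G)` of a finite graph in the sense of its largest adjacency eigenvalue:
the supremum of the (finite) real spectrum of the adjacency matrix, which is symmetric. It is a
maximum as soon as the graph has a vertex. -/
noncomputable def adjSpectralRadius {V : Type*} [Fintype V] (G : SimpleGraph V) : ℝ := by
  classical exact sSup (spectrum ℝ (G.adjMatrix ℝ))

/-- The join `G ∇ H`: the disjoint union of `G` and `H` together with all edges between them. -/
def joinGraph {V W : Type*} (G : SimpleGraph V) (H : SimpleGraph W) : SimpleGraph (V ⊕ W) :=
  (G ⊕g H) ⊔ completeBipartiteGraph V W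

/-- `G` is `k`-extendable: it has a matching of size `k` (that is, with `k` edges), and every
matching of size `k` is contained in a perfect matching of `G`. -/
def IsExtendable {V : Type*} (G : SimpleGraph V) (k : ℕ) : Prop :=
  (∃ M : G.Subgraph, M.IsMatching ∧ M.edgeSet.encard = k) ∧
    ∀ M : G.Subgraph, M.IsMatching → M.edgeSet.encard = k →
      ∃ P : G.Subgraph, P.IsPerfectMatching ∧ M ≤ P

/-- The graph `K_δ ∇ (K_{n-2δ+2k-1} ∪ (δ-2k+1) K_1)`. It is meant for `2k ≤ δ` and `2δ ≤ n`, `1 ≤ k`,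
where no subtraction below is truncated. -/
def extremalGraph (n k δ : ℕ) :
    SimpleGraph (Fin δ ⊕ (Fin (n - 2 * δ + 2 * k - 1) ⊕ Fin (δ - 2 * k + 1))) :=
  joinGraph (⊤ : SimpleGraph (Fin δ))
    ((⊤ : SimpleGraph (Fin (n - 2 * δ + 2 * k - 1))) ⊕g (⊥ : SimpleGraph (Fin (δ - 2 * k + 1))))

end SimpleGraph

/-! Put d = δ - 2k and N = n - 2δ + 2k - 1. If a k-matching M lies in no perfect matching, Tutte's
theorem applied to G - V(M) gives a set S containing V(M), with s = |S|, such that G - S has at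
least s - 2k + 2 components (`exists_barrier`). Hence G is a subgraph of the join of K_s with
disjoint cliques of the component sizes m_c.

Let θ = c + ε be an eigenvalue of the extremal graph, where c = N + δ - 1 is the spectral radius of
its subgraph K_{N+δ}. The positive vector equal to 1 on S and to s / (θ - m_c + 1) on component c
satisfies A y ≤ θ y as soon as s - 1 + s ∑ m_c / (θ - m_c + 1) ≤ θ. By convexity
(`sum_div_le_of_parts`) the sum is largest when all components but one are as small as possible,
which leaves a polynomial inequality. For s ≠ δ the bounds on n make it strict, contradicting ρ(G) ≥
θ. For s = δ it is an equality, and the equality case of Collatz–Wielandt makes every permitted edge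
present, so G is the extremal graph.

Conversely, in the extremal graph a k-matching inside K_δ leaves only δ - 2k vertices as partners
for δ - 2k + 1 independent ones. -/

open Finset

universe u

/-! ### Eigenvectors and the spectral radius. -/

namespace SimpleGraph

/-- Equality case of the Collatz–Wielandt bound: if a positive vector `y` satisfies `A y ≤ θ y` on a
connected graph and the graph has an eigenvalue at least `θ`, then `A y = θ y`. -/
theorem Connected.sum_neighborFinset_eq_of_le_eigenvalue {V : Type*} [Fintype V]
    {G : SimpleGraph V} [DecidableRel G.Adj] (hG : G.Connected) {y x : V → ℝ} {θ μ : ℝ}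
    (hy : ∀ v, 0 < y v) (hθ : 0 < θ) (hle : ∀ v, ∑ w ∈ G.neighborFinset v, y w ≤ θ * y v)
    (hx : x ≠ 0) (hev : ∀ v, ∑ w ∈ G.neighborFinset v, x w = μ * x v) (hμ : θ ≤ μ) (v : V) :
    ∑ w ∈ G.neighborFinset v, y w = θ * y v := by
  classical
  have := hG.nonempty
  obtain ⟨i, -, hi⟩ := exists_max_image univ (fun v => |x v| / y v) univ_nonempty
  set R := |x i| / y i with hR
  have hbd : ∀ w, |x w| ≤ R * y w := fun w => by
    have := hi w (mem_univ _)
    rwa [div_le_iff₀ (hy w)] at this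
  have hRpos : 0 < R := by
    obtain ⟨j, hj⟩ := Function.ne_iff.1 hx
    have h1 : 0 < |x j| := abs_pos.2 hj
    have h2 := hbd j
    by_contra h
    have := mul_nonpos_of_nonpos_of_nonneg (not_lt.1 h) (hy j).le
    linarith
  -- Where |x| / y attains its maximum R, the chain θ|x| ≤ μ|x| ≤ ∑|x| ≤ R ∑ y ≤ θ|x| collapses to
  -- equalities. So every neighbour attains R too, and connectedness spreads this to all vertices.
  have key : ∀ w, |x w| = R * y w →
      ∑ z ∈ G.neighborFinset w, y z = θ * y w ∧ ∀ z, G.Adj w z → |x z| = R * y z := by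
    intro w hw
    have h1 : μ * |x w| ≤ ∑ z ∈ G.neighborFinset w, |x z| := by
      calc μ * |x w| = |μ * x w| := by rw [abs_mul, abs_of_nonneg (hθ.le.trans hμ)]
        _ = |∑ z ∈ G.neighborFinset w, x z| := by rw [hev]
        _ ≤ _ := abs_sum_le_sum_abs _ _
    have h2 : ∑ z ∈ G.neighborFinset w, |x z| ≤ ∑ z ∈ G.neighborFinset w, R * y z :=
      sum_le_sum fun z _ => hbd z
    have h3 : ∑ z ∈ G.neighborFinset w, R * y z = R * ∑ z ∈ G.neighborFinset w, y z :=
      (mul_sum _ _ _).symm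
    have h4 : θ * |x w| ≤ μ * |x w| := mul_le_mul_of_nonneg_right hμ (abs_nonneg _)
    have h5 : R * ∑ z ∈ G.neighborFinset w, y z ≤ R * (θ * y w) :=
      mul_le_mul_of_nonneg_left (hle w) hRpos.le
    have h6 : R * (θ * y w) = θ * |x w| := by rw [hw]; ring
    constructor
    · exact mul_left_cancel₀ hRpos.ne' (by linarith)
    · intro z hz
      exact (sum_eq_sum_iff_of_le fun z _ => hbd z).1 (by linarith) z
        ((G.mem_neighborFinset w z).2 hz)
  have hall : ∀ w, |x w| = R * y w := by
    intro w
    obtain ⟨p⟩ := hG.preconnected i w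
    have hi0 : |x i| = R * y i := by rw [hR, div_mul_cancel₀ _ (hy i).ne']
    clear_value R
    clear hR
    induction p with
    | nil => exact hi0
    | cons h p ih => exact ih ((key _ hi0).2 _ h)
  exact (key v (hall v)).1

theorem mem_spectrum_adjMatrix_iff {V : Type*} [Fintype V] [DecidableEq V] (G : SimpleGraph V)
    [DecidableRel G.Adj] (μ : ℝ) : μ ∈ spectrum ℝ (G.adjMatrix ℝ) ↔
      ∃ x : V → ℝ, x ≠ 0 ∧ ∀ v, ∑ w ∈ G.neighborFinset v, x w = μ * x v := by
  rw [← Matrix.spectrum_toLin', ← Module.End.hasEigenvalue_iff_mem_spectrum]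
  constructor
  · intro h
    obtain ⟨x, hx⟩ := h.exists_hasEigenvector
    refine ⟨x, hx.2, fun v => ?_⟩
    have := congrFun hx.apply_eq_smul v
    rwa [Matrix.toLin'_apply, adjMatrix_mulVec_apply, Pi.smul_apply, smul_eq_mul] at this
  · rintro ⟨x, hx, h⟩
    refine Module.End.hasEigenvalue_of_hasEigenvector (x := x)
      ⟨Module.End.mem_eigenspace_iff.2 ?_, hx⟩
    ext v
    rw [Matrix.toLin'_apply, adjMatrix_mulVec_apply, Pi.smul_apply, smul_eq_mul, h]

theorem adjSpectralRadius_eq {V : Type*} [Fintype V] [DecidableEq V] (G : SimpleGraph V)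
    [DecidableRel G.Adj] : G.adjSpectralRadius = sSup (spectrum ℝ (G.adjMatrix ℝ)) := by
  unfold adjSpectralRadius
  congr!

theorem le_adjSpectralRadius {V : Type*} [Fintype V] (G : SimpleGraph V) [DecidableRel G.Adj]
    {x : V → ℝ} {μ : ℝ} (hx : x ≠ 0) (h : ∀ v, ∑ w ∈ G.neighborFinset v, x w = μ * x v) :
    μ ≤ G.adjSpectralRadius := by
  classical
  rw [adjSpectralRadius_eq]
  exact le_csSup (Matrix.finite_spectrum _).bddAbove
    ((mem_spectrum_adjMatrix_iff G μ).2 ⟨x, hx, h⟩)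

theorem exists_eigenvector_of_le_adjSpectralRadius {V : Type*} [Fintype V] (G : SimpleGraph V)
    [DecidableRel G.Adj] {θ : ℝ} (hθ : 0 < θ) (h : θ ≤ G.adjSpectralRadius) :
    ∃ μ, θ ≤ μ ∧ ∃ x : V → ℝ, x ≠ 0 ∧ ∀ v, ∑ w ∈ G.neighborFinset v, x w = μ * x v := by
  classical
  refine ⟨_, h, (mem_spectrum_adjMatrix_iff G _).1 ?_⟩
  rw [adjSpectralRadius_eq] at h ⊢
  -- The supremum of the empty set is 0 by convention, so `hθ` excludes an empty spectrum.
  rcases (spectrum ℝ (G.adjMatrix ℝ)).eq_empty_or_nonempty with he | hne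
  · rw [he, Real.sSup_empty] at h
    exact absurd h (not_le.2 hθ)
  · exact hne.csSup_mem (Matrix.finite_spectrum _)

/-! ### Matchings, Tutte barriers and non-extendability. -/

theorem Subgraph.IsMatching.ncard_verts {V : Type*} [Finite V] {G : SimpleGraph V}
    {M : G.Subgraph} (hM : M.IsMatching) : M.verts.ncard = 2 * M.edgeSet.ncard := by
  classical
  have := Fintype.ofFinite V
  have hfib : ∀ e ∈ (univ : Finset M.edgeSet), #{v : M.verts | hM.toEdge v = e} = 2 := by
    rintro ⟨⟨u, v⟩, he⟩ -
    have huv : M.Adj u v := he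
    have h2 : ({x : M.verts | hM.toEdge x = ⟨s(u, v), he⟩} : Finset M.verts) =
        {⟨u, huv.fst_mem⟩, ⟨v, huv.snd_mem⟩} := by
      ext x
      have := Set.ext_iff.1 (hM.toEdge_preimage_singleton huv) x
      simpa using this
    refine (congrArg Finset.card h2).trans (card_pair ?_)
    simpa using huv.ne
  have := card_eq_sum_card_fiberwise (f := hM.toEdge) (s := univ) (t := univ)
    fun _ _ => mem_coe.2 (mem_univ _)
  rw [sum_congr rfl hfib, sum_const, smul_eq_mul, card_univ, card_univ] at this
  rw [← Nat.card_coe_set_eq, ← Nat.card_coe_set_eq, Nat.card_eq_fintype_card,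
    Nat.card_eq_fintype_card]
  omega

/-- Greedy construction: a matching with fewer than k edges covers at most 2k - 2 vertices, so an
edge avoiding it remains. It serves both for cliques and for large minimum degree. -/
theorem exists_isMatching_of_forall_exists_adj {V : Type*} [Finite V] (G : SimpleGraph V)
    (D : Set V) (k : ℕ)
    (h : ∀ T ⊆ D, T.ncard + 2 ≤ 2 * k → ∃ u ∈ D \ T, ∃ v ∈ D \ T, G.Adj u v) :
    ∃ M : G.Subgraph, M.IsMatching ∧ M.edgeSet.ncard = k ∧ M.verts ⊆ D := by
  suffices H : ∀ j ≤ k, ∃ M : G.Subgraph, M.IsMatching ∧ M.edgeSet.ncard = j ∧ M.verts ⊆ D from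
    H k le_rfl
  intro j
  induction j with
  | zero => exact fun _ => ⟨⊥, fun v hv => by simp at hv, by simp, by simp⟩
  | succ j ih =>
    intro hj
    obtain ⟨M, hM, hMj, hMD⟩ := ih (by omega)
    obtain ⟨u, hu, v, hv, huv⟩ := h M.verts hMD (by rw [hM.ncard_verts]; omega)
    have hdisj : Disjoint M.support (G.subgraphOfAdj huv).support := by
      rw [hM.support_eq_verts, (Subgraph.IsMatching.subgraphOfAdj huv).support_eq_verts,
        Set.disjoint_left]
      rintro x hx hx'
      rcases hx' with rfl | rfl
      exacts [hu.2 hx, hv.2 hx]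
    refine ⟨M ⊔ G.subgraphOfAdj huv, hM.sup (Subgraph.IsMatching.subgraphOfAdj huv) hdisj, ?_, ?_⟩
    · rw [Subgraph.edgeSet_sup, edgeSet_subgraphOfAdj, Set.union_singleton,
        Set.ncard_insert_of_notMem, hMj]
      exact fun he => hu.2 (M.edge_vert he)
    · rw [Subgraph.verts_sup]
      refine Set.union_subset hMD ?_
      rintro x (rfl | rfl)
      exacts [hu.1, hv.1]

/-- A matching `M` of `G` extends to a perfect matching as soon as the vertices it misses
induce a graph with a perfect matching. -/
theorem Subgraph.IsMatching.exists_isPerfectMatching_ge {V : Type*} {G : SimpleGraph V}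
    {M : G.Subgraph} (hM : M.IsMatching) {P : (G.induce M.vertsᶜ).Subgraph}
    (hP : P.IsPerfectMatching) : ∃ Q : G.Subgraph, Q.IsPerfectMatching ∧ M ≤ Q := by
  let φ := (Embedding.induce (G := G) M.vertsᶜ)
  have hP' := hP.1.map φ.toHom φ.injective
  refine ⟨M ⊔ P.map φ.toHom, ⟨hM.sup hP' ?_, ?_⟩, le_sup_left⟩
  · rw [hM.support_eq_verts, hP'.support_eq_verts, Set.disjoint_left]
    rintro _ hx ⟨x, -, rfl⟩
    exact x.2 hx
  · intro v
    by_cases hv : v ∈ M.verts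
    · exact Or.inl hv
    · exact Or.inr ⟨⟨v, hv⟩, hP.2 _, rfl⟩

/-- If `k` matching edges are contained in no perfect matching, then deleting a suitable set
(the fibre of `none`) of `s ≥ 2 * k` vertices leaves at least `s - 2 * k + 2` components
(the other fibres). -/
theorem exists_barrier {V : Type u} [Fintype V] [DecidableEq V] {G : SimpleGraph V}
    (heven : Even (Fintype.card V)) {M : G.Subgraph} (hM : M.IsMatching)
    (hno : ∀ P : G.Subgraph, P.IsPerfectMatching → ¬ M ≤ P) :
    ∃ (K : Type u) (_ : Fintype K) (_ : DecidableEq K) (f : V → Option K),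
      (∀ c, ∃ v, f v = some c) ∧
      (∀ v w c d, G.Adj v w → f v = some c → f w = some d → c = d) ∧
      2 * M.edgeSet.ncard ≤ #{v | f v = none} ∧
      #{v | f v = none} + 2 ≤ Fintype.card K + 2 * M.edgeSet.ncard := by
  classical
  have hV := hM.ncard_verts
  have hnoP : ¬ ∃ P : (G.induce M.vertsᶜ).Subgraph, P.IsPerfectMatching := by
    rintro ⟨P, hP⟩
    obtain ⟨Q, hQ, hMQ⟩ := hM.exists_isPerfectMatching_ge hP
    exact hno Q hQ hMQ
  rw [tutte] at hnoP
  push Not at hnoP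
  obtain ⟨U, hU⟩ := hnoP
  unfold IsTutteViolator at hU
  set H := ((⊤ : (G.induce M.vertsᶜ).Subgraph).deleteVerts U) with hH
  have hmem : ∀ x, x ∈ H.verts ↔ x ∉ U := fun x => by simp [hH]
  have hfin : Fintype H.coe.ConnectedComponent := Fintype.ofFinite _
  let f : V → Option H.coe.ConnectedComponent := fun v =>
    if h : ∃ hv : v ∉ M.verts, (⟨v, hv⟩ : (M.vertsᶜ : Set V)) ∉ U then
      some (H.coe.connectedComponentMk ⟨⟨v, h.1⟩, (hmem _).2 h.2⟩) else none
  have hf : ∀ x : H.verts, f x.1.1 = some (H.coe.connectedComponentMk x) := by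
    intro x
    have : ∃ hv : x.1.1 ∉ M.verts, (⟨x.1.1, hv⟩ : (M.vertsᶜ : Set V)) ∉ U :=
      ⟨x.1.2, (hmem _).1 x.2⟩
    simp only [f, dif_pos this]
  have hf' : ∀ v c, f v = some c → ∃ x : H.verts, x.1.1 = v ∧ H.coe.connectedComponentMk x = c := by
    intro v c hvc
    by_cases h : ∃ hv : v ∉ M.verts, (⟨v, hv⟩ : (M.vertsᶜ : Set V)) ∉ U
    · refine ⟨⟨⟨v, h.1⟩, (hmem _).2 h.2⟩, rfl, ?_⟩
      simpa only [f, dif_pos h, Option.some.injEq] using hvc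
    · simp [f, dif_neg h] at hvc
  have hnone : ({v | f v = none} : Set V) = M.verts ∪ Subtype.val '' U := by
    ext v
    simp only [f, Set.mem_ofPred_eq, dite_eq_right_iff, reduceCtorEq, imp_false, Set.mem_union,
      Set.mem_image, Subtype.exists, exists_and_right, exists_eq_right, Set.mem_compl_iff]
    by_cases hv : v ∈ M.verts <;> simp [hv]
  have hcard : #{v | f v = none} = 2 * M.edgeSet.ncard + U.ncard := by
    rw [← Set.ncard_coe_finset, coe_filter_univ, hnone, Set.ncard_union_eq, hV,
      Set.ncard_image_of_injective _ Subtype.val_injective]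
    rw [Set.disjoint_left]
    rintro _ hx ⟨x, -, rfl⟩
    exact x.2 hx
  -- The number of odd components has the parity of |H|, hence of |U|, since |V| and |V(M)| are
  -- even. A violation of Tutte's condition is therefore by at least 2.
  have hodd := odd_ncard_oddComponents H.coe
  have hHU : Nat.card H.verts + U.ncard + M.verts.ncard = Fintype.card V := by
    have h1 : H.verts = Uᶜ := by ext x; exact hmem x
    have h2 := Set.ncard_add_ncard_compl U
    have h3 := Set.ncard_add_ncard_compl M.verts
    rw [Nat.card_coe_set_eq, h1]
    rw [Nat.card_coe_set_eq] at h2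
    rw [Nat.card_eq_fintype_card] at h3
    omega
  have hK : H.coe.oddComponents.ncard ≤ Fintype.card H.coe.ConnectedComponent := by
    rw [← Nat.card_eq_fintype_card]
    exact Set.ncard_le_card _
  refine ⟨H.coe.ConnectedComponent, hfin, inferInstance, f, ?_, ?_, by omega, ?_⟩
  · intro c
    obtain ⟨x, rfl⟩ := c.exists_rep
    exact ⟨x.1.1, hf x⟩
  · intro v w c d hvw hv hw
    obtain ⟨x, rfl, rfl⟩ := hf' v c hv
    obtain ⟨y, rfl, rfl⟩ := hf' w d hw
    refine ConnectedComponent.sound (Adj.reachable ?_)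
    have hx := (hmem _).1 x.2
    have hy := (hmem _).1 y.2
    simp [hH, hx, hy, hvw]
  · rw [hcard]
    rw [Nat.odd_iff, Nat.odd_iff] at hodd
    rw [Nat.even_iff] at heven
    omega

/-- A k-matching inside the clique D uses up 2k of its vertices. In a perfect matching extending it,
I would inject into the fewer than |I| that remain. -/
theorem not_isExtendable_of_isIndepSet {V : Type*} [Fintype V] [DecidableEq V]
    {G : SimpleGraph V} {k : ℕ} {D I : Finset V} (hD : ∀ u ∈ D, ∀ v ∈ D, u ≠ v → G.Adj u v)
    (hI : ∀ u ∈ I, ∀ v, G.Adj u v → v ∈ D) (hk : 2 * k ≤ #D) (hDI : Disjoint D I)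
    (hcard : #D < #I + 2 * k) : ¬ G.IsExtendable k := by
  rintro ⟨-, h⟩
  obtain ⟨M, hM, hMk, hMD⟩ := G.exists_isMatching_of_forall_exists_adj (D : Set V) k (by
    intro T hT hTk
    have h1 := Set.ncard_sdiff_add_ncard_of_subset hT
    rw [Set.ncard_coe_finset] at h1
    obtain ⟨u, v, hu, hv, huv⟩ := (Set.one_lt_ncard_iff).1
      (show 1 < ((D : Set V) \ T).ncard by omega)
    exact ⟨u, hu, v, hv, hD u hu.1 v hv.1 huv⟩)
  obtain ⟨P, hP, hMP⟩ := h M hM (by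
    rw [← hMk]
    exact (Set.Finite.cast_ncard_eq (Set.toFinite _)).symm)
  have hPv : ∀ v, ∃ w, P.Adj v w := fun v => (hP.1 (hP.2 v)).exists
  choose g hg using hPv
  have hmaps : Set.MapsTo g I ((D : Set V) \ M.verts : Set V) := by
    intro u hu
    refine ⟨hI u hu _ (hg u).adj_sub, fun hgu => ?_⟩
    obtain ⟨w, hw⟩ := (hM hgu).exists
    have := hP.1.eq_of_adj_left (hg u).symm (hMP.2 hw)
    subst this
    exact Finset.disjoint_left.1 hDI (hMD hw.snd_mem) hu
  have hinj : Set.InjOn g I := fun u _ v _ huv => hP.1.eq_of_adj_right (hg u) (huv ▸ hg v)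
  have h1 := Set.ncard_le_ncard_of_injOn g hmaps hinj
  have h2 := Set.ncard_sdiff_add_ncard_of_subset hMD
  rw [hM.ncard_verts, Set.ncard_coe_finset] at h2
  rw [Set.ncard_coe_finset] at h1
  omega

end SimpleGraph

/-! ### Convexity in the component sizes. -/

theorem div_sub_add_one_sub_div {θ a m : ℝ} (ha : 0 < θ - a + 1) (hm : 0 < θ - m + 1) :
    m / (θ - m + 1) - a / (θ - a + 1) =
      (m - a) * (θ + 1) / ((θ - m + 1) * (θ - a + 1)) := by
  field_simp
  ring

/-- Convexity of `m ↦ m / (θ - m + 1)`: the sum of its values over parts `m c ≥ a` of a fixed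
total is largest when all parts but one equal `a`; the second statement is the equality case. -/
theorem sum_div_le_of_parts {K : Type*} [Fintype K] {m : K → ℝ} {θ a M Q : ℝ}
    (ha : 0 < a) (haM : a ≤ M) (hM : 0 < θ - M + 1) (hm : ∀ c, a ≤ m c)
    (hsum : ∑ c, m c = M + Q * a) (hQ : Q + 1 ≤ Fintype.card K) :
    (∀ c, m c ≤ M) ∧
    ∑ c, m c / (θ - m c + 1) ≤ M / (θ - M + 1) + Q * (a / (θ - a + 1)) ∧
    (∑ c, m c / (θ - m c + 1) = M / (θ - M + 1) + Q * (a / (θ - a + 1)) →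
      (Fintype.card K : ℝ) = Q + 1 ∧ ∀ c, m c = a ∨ m c = M) := by
  classical
  have hmM : ∀ c, m c ≤ M := by
    intro c
    have h1 := sum_erase_add univ m (mem_univ c)
    have h2 : ∑ c ∈ univ.erase c, a ≤ ∑ c ∈ univ.erase c, m c := sum_le_sum fun c _ => hm c
    rw [sum_const, nsmul_eq_mul, card_erase_of_mem (mem_univ c), card_univ,
      Nat.cast_sub (Fintype.card_pos_iff.2 ⟨c⟩), Nat.cast_one] at h2
    nlinarith
  have hA : 0 < θ - a + 1 := by linarith
  have hθ : 0 < θ + 1 := by linarith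
  -- Slope of the chord of m ↦ m / (θ - m + 1) over [a, M].
  set σ := (θ + 1) / ((θ - M + 1) * (θ - a + 1)) with hσ
  have hchord : ∀ c, a / (θ - a + 1) + (m c - a) * σ - m c / (θ - m c + 1) =
      (m c - a) * (M - m c) * ((θ + 1) / ((θ - M + 1) * (θ - a + 1) * (θ - m c + 1))) := by
    intro c
    have hc : 0 < θ - m c + 1 := by linarith [hmM c]
    have := div_sub_add_one_sub_div hA hc
    rw [hσ]
    have e : a / (θ - a + 1) = m c / (θ - m c + 1) -
      (m c - a) * (θ + 1) / ((θ - m c + 1) * (θ - a + 1)) := by linarith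
    rw [e]
    field_simp
    ring
  have hpos : ∀ c, 0 < (θ + 1) / ((θ - M + 1) * (θ - a + 1) * (θ - m c + 1)) := by
    intro c
    have hc : 0 < θ - m c + 1 := by linarith [hmM c]
    positivity
  have hslack : ∀ c, 0 ≤ (m c - a) * (M - m c) *
      ((θ + 1) / ((θ - M + 1) * (θ - a + 1) * (θ - m c + 1))) := fun c =>
    mul_nonneg (mul_nonneg (sub_nonneg.2 (hm c)) (sub_nonneg.2 (hmM c))) (hpos c).le
  -- The chord has value -aM / ((θ - M + 1)(θ - a + 1)) at 0. As the total is fixed, each part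
  -- beyond Q + 1 costs that much, and equality also forces the number of parts.
  have hid : M / (θ - M + 1) + Q * (a / (θ - a + 1)) - ∑ c, m c / (θ - m c + 1) =
      ∑ c, (m c - a) * (M - m c) * ((θ + 1) / ((θ - M + 1) * (θ - a + 1) * (θ - m c + 1))) +
      (Fintype.card K - (Q + 1)) * (a * M / ((θ - M + 1) * (θ - a + 1))) := by
    rw [← sum_congr rfl fun c _ => hchord c, sum_sub_distrib, sum_add_distrib, ← sum_mul,
      sum_sub_distrib, hsum, sum_const, sum_const, card_univ, nsmul_eq_mul, nsmul_eq_mul, hσ]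
    have e := div_sub_add_one_sub_div hA hM
    have e' : M / (θ - M + 1) = a / (θ - a + 1) +
      (M - a) * (θ + 1) / ((θ - M + 1) * (θ - a + 1)) := by linarith
    rw [e']
    field_simp
    ring
  have hM0 : 0 < M := by linarith
  have hlast : 0 < a * M / ((θ - M + 1) * (θ - a + 1)) := by positivity
  have hs0 := sum_nonneg fun c (_ : c ∈ univ) => hslack c
  have hl0 := mul_nonneg (sub_nonneg.2 hQ) hlast.le
  refine ⟨hmM, by linarith, fun heq => ?_⟩
  have h1 : (Fintype.card K - (Q + 1)) * (a * M / ((θ - M + 1) * (θ - a + 1))) = 0 := by linarith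
  have h2 : ∑ c, (m c - a) * (M - m c) *
      ((θ + 1) / ((θ - M + 1) * (θ - a + 1) * (θ - m c + 1))) = 0 := by linarith
  refine ⟨?_, fun c => ?_⟩
  · rcases mul_eq_zero.1 h1 with h | h
    · linarith
    · exact absurd h hlast.ne'
  · have := (sum_eq_zero_iff_of_nonneg fun c _ => hslack c).1 h2 c (mem_univ c)
    rcases mul_eq_zero.1 this with h | h
    · rcases mul_eq_zero.1 h with h | h
      · left; linarith
      · right; linarith
    · exact absurd h (hpos c).ne'

namespace SimpleGraph

/-! ### Collatz–Wielandt comparison across a barrier. -/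

section Barrier

variable {V K : Type*} [Fintype V] [DecidableEq V] [DecidableEq K] {G : SimpleGraph V}
  [DecidableRel G.Adj] {f : V → Option K}

/-- The possible neighbours of `v` when the fibre of `none` separates the other fibres of `f`. -/
def barrierNeighbors (f : V → Option K) (v : V) : Finset V :=
  {w | w ≠ v ∧ (f v = none ∨ f w = none ∨ f v = f w)}

theorem neighborFinset_subset_barrierNeighbors
    (hadj : ∀ v w c d, G.Adj v w → f v = some c → f w = some d → c = d) (v : V) :
    G.neighborFinset v ⊆ barrierNeighbors f v := by
  intro w hw
  rw [mem_neighborFinset] at hw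
  refine mem_filter.2 ⟨mem_univ _, hw.ne', ?_⟩
  rcases hv : f v with - | c
  · exact Or.inl rfl
  rcases hw' : f w with - | d
  · exact Or.inr (Or.inl rfl)
  · exact Or.inr (Or.inr (congrArg some (hadj v w c d hw hv hw')))

theorem barrierNeighbors_of_eq_none {v : V} (hv : f v = none) :
    barrierNeighbors f v = univ.erase v := by
  ext w
  simp [barrierNeighbors, hv]

theorem sum_barrierNeighbors_of_eq_some (g : V → ℝ) {v : V} {c : K} (hv : f v = some c) :
    ∑ w ∈ barrierNeighbors f v, g w + g v =
      ∑ w with f w = none, g w + ∑ w with f w = some c, g w := by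
  have h1 : barrierNeighbors f v =
      ({w | f w = none} : Finset V) ∪ ({w | f w = some c} : Finset V).erase v := by
    ext w
    simp only [barrierNeighbors, hv, mem_filter_univ, mem_union, mem_erase, reduceCtorEq, false_or]
    constructor
    · rintro ⟨h, h' | h'⟩
      exacts [Or.inl h', Or.inr ⟨h, h'.symm⟩]
    · rintro (h | ⟨h, h'⟩)
      · refine ⟨?_, Or.inl h⟩
        rintro rfl
        rw [hv] at h
        cases h
      · exact ⟨h, Or.inr h'.symm⟩
  have h2 : Disjoint ({w | f w = none} : Finset V) (({w | f w = some c} : Finset V).erase v) := by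
    rw [Finset.disjoint_left]
    intro w hw hw'
    rw [mem_filter_univ] at hw
    rw [mem_erase, mem_filter_univ, hw] at hw'
    cases hw'.2
  rw [h1, sum_union h2, add_assoc, sum_erase_add _ _ (by simpa using hv)]

theorem degree_lt_of_barrier
    (hadj : ∀ v w c d, G.Adj v w → f v = some c → f w = some d → c = d) {v : V} {c : K}
    (hv : f v = some c) : G.degree v + 1 ≤ #{w | f w = none} + #{w | f w = some c} := by
  have h1 := card_le_card (neighborFinset_subset_barrierNeighbors hadj v)
  have h2 := sum_barrierNeighbors_of_eq_some (fun _ => 1) hv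
  simp only [sum_const, nsmul_eq_mul, mul_one] at h2
  rw [card_neighborFinset_eq_degree] at h1
  have h3 : #(barrierNeighbors f v) + 1 = #{w | f w = none} + #{w | f w = some c} := by
    exact_mod_cast h2
  omega

/-- The weights s / (θ - m c + 1) solve the eigenvalue equation exactly on the components of the
full join, so only the rows of the barrier impose a condition. A missing edge would make some row
sum strictly smaller, as the weights are positive. -/
theorem Connected.adj_of_barrier_of_le_eigenvalue [Fintype K] (hG : G.Connected)
    (hadj : ∀ v w c d, G.Adj v w → f v = some c → f w = some d → c = d)
    {s θ μ : ℝ} {m : K → ℝ} (hs : s = #{w | f w = none}) (hs0 : 0 < s)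
    (hm : ∀ c, m c = #{w | f w = some c}) (hθ : 0 < θ) (hmθ : ∀ c, 0 < θ - m c + 1)
    (hle : s - 1 + s * ∑ c, m c / (θ - m c + 1) ≤ θ) {x : V → ℝ} (hx : x ≠ 0)
    (hev : ∀ v, ∑ w ∈ G.neighborFinset v, x w = μ * x v) (hμ : θ ≤ μ) :
    s - 1 + s * ∑ c, m c / (θ - m c + 1) = θ ∧
      ∀ v w, v ≠ w → (f v = none ∨ f w = none ∨ f v = f w) → G.Adj v w := by
  let Y : Option K → ℝ := fun o => o.elim 1 fun c => s / (θ - m c + 1)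
  let y : V → ℝ := fun v => Y (f v)
  have hY : ∀ o, 0 < Y o := by
    rintro (- | c)
    · exact one_pos
    · exact div_pos hs0 (hmθ c)
  have hfib : ∀ o, ∑ w with f w = o, y w = #{w | f w = o} * Y o := by
    intro o
    rw [← nsmul_eq_mul, ← sum_const]
    refine sum_congr rfl fun w hw => ?_
    simp only [y, (mem_filter_univ w).1 hw]
  have htot : ∑ w, y w = s + s * ∑ c, m c / (θ - m c + 1) := by
    rw [← sum_fiberwise univ f y, Fintype.sum_option, mul_sum, hfib, ← hs]
    refine congrArg₂ _ (mul_one s) (sum_congr rfl fun c _ => ?_)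
    rw [hfib, ← hm]
    change m c * (s / (θ - m c + 1)) = _
    ring
  have hnone : ∀ v, f v = none → ∑ w ∈ barrierNeighbors f v, y w =
      s - 1 + s * ∑ c, m c / (θ - m c + 1) := by
    intro v hv
    have h1 := sum_erase_add univ y (mem_univ v)
    have h2 : y v = 1 := by simp only [y, hv]; rfl
    rw [barrierNeighbors_of_eq_none hv]
    linarith
  have hsome : ∀ v c, f v = some c → ∑ w ∈ barrierNeighbors f v, y w = θ * y v := by
    intro v c hv
    have h1 := sum_barrierNeighbors_of_eq_some y hv
    rw [hfib, hfib, ← hs, ← hm] at h1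
    have h2 : y v = s / (θ - m c + 1) := by simp only [y, hv]; rfl
    change _ = s * 1 + m c * (s / (θ - m c + 1)) at h1
    rw [h2] at h1 ⊢
    have h3 : (θ - m c + 1) * (s / (θ - m c + 1)) = s := mul_div_cancel₀ _ (hmθ c).ne'
    linarith
  have hsub := neighborFinset_subset_barrierNeighbors hadj
  have hB : ∀ v, ∑ w ∈ barrierNeighbors f v, y w ≤ θ * y v := by
    intro v
    rcases hv : f v with - | c
    · have h2 : y v = 1 := by simp only [y, hv]; rfl
      rw [hnone v hv, h2, mul_one]
      exact hle
    · exact (hsome v c hv).le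
  have hNB : ∀ v, ∑ w ∈ G.neighborFinset v, y w ≤ ∑ w ∈ barrierNeighbors f v, y w := fun v =>
    sum_le_sum_of_subset_of_nonneg (hsub v) fun w _ _ => (hY _).le
  have hN := hG.sum_neighborFinset_eq_of_le_eigenvalue (y := y) (fun v => hY _) hθ
    (fun v => (hNB v).trans (hB v)) hx hev hμ
  constructor
  · have hne : ({w | f w = none} : Finset V).Nonempty := by
      rw [← card_pos]
      exact_mod_cast hs ▸ hs0
    obtain ⟨v, hv⟩ := hne
    rw [mem_filter_univ] at hv
    have h1 := hNB v
    have h2 : y v = 1 := by simp only [y, hv]; rfl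
    rw [hN, hnone v hv, h2] at h1
    linarith
  · intro v w hvw h
    by_contra hn
    have : ∑ w ∈ G.neighborFinset v, y w < ∑ w ∈ barrierNeighbors f v, y w :=
      sum_lt_sum_of_subset (hsub v) (mem_filter.2 ⟨mem_univ w, hvw.symm, h⟩)
        (by rwa [mem_neighborFinset]) (hY _) fun w _ _ => (hY _).le
    linarith [hN v, hB v]

end Barrier

end SimpleGraph

/-! ### Polynomial inequalities and the choice of θ. -/

/-- The quotient inequality at a barrier of `s` vertices with component sizes `M, a, …, a`, where
`M = c + 1 - s - u` and `θ = c + ε`, after clearing denominators. -/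
theorem sub_quotient_bound_eq {s Q a u c ε : ℝ} (hs : 0 < s + u + ε) (ha : 0 < c + ε + 1 - a) :
    c + ε - (s - 1 + s * ((c + 1 - s - u) / (c + ε - (c + 1 - s - u) + 1) +
      Q * (a / (c + ε - a + 1)))) =
    ((u + ε) * (c + ε + 1) * (c + ε + 1 - a) - s * Q * a * (s + u + ε)) /
      ((s + u + ε) * (c + ε + 1 - a)) := by
  have e1 : c + ε - (c + 1 - s - u) + 1 = s + u + ε := by ring
  have e2 : c + ε - a + 1 = c + ε + 1 - a := by ring
  rw [e1, e2]
  field_simp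
  ring

/-- For u > 0 the value of ε is irrelevant: (u + ε) / (s + u + ε) and the two other factors on the
right increase with ε, so the integer inequality at ε = 0 suffices. -/
theorem cleared_quotient_bound_of_excess_zero {s Q a u c ε : ℝ} (hε : 0 ≤ ε) (hu : 0 < u) (hsQa : 0 ≤ s * Q * a)
    (hs : 0 ≤ s) (hc : 0 ≤ c + 1 - a) (hc' : 0 ≤ c + 1)
    (h : s * Q * a * (s + u) < u * (c + 1) * (c + 1 - a)) :
    s * Q * a * (s + u + ε) < (u + ε) * (c + ε + 1) * (c + ε + 1 - a) := by
  have h1 : u * (s + u + ε) ≤ (s + u) * (u + ε) := by nlinarith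
  have h2 : (c + 1) * (c + 1 - a) ≤ (c + ε + 1) * (c + ε + 1 - a) :=
    mul_le_mul (by linarith) (by linarith) hc (by linarith)
  have h3 : u * (s * Q * a * (s + u + ε)) ≤ s * Q * a * (s + u) * (u + ε) := by
    have := mul_le_mul_of_nonneg_left h1 hsQa
    linarith
  have h4 : s * Q * a * (s + u) * (u + ε) < u * (c + 1) * (c + 1 - a) * (u + ε) :=
    mul_lt_mul_of_pos_right h (by linarith)
  have h5 : (u * (u + ε)) * ((c + 1) * (c + 1 - a)) ≤
      (u * (u + ε)) * ((c + ε + 1) * (c + ε + 1 - a)) :=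
    mul_le_mul_of_nonneg_left h2 (by positivity)
  refine lt_of_mul_lt_mul_left (a := u) ?_ hu.le
  linarith

/-- Case s = δ + r: here a = 1, Q = d + r + 1 and u = r. The hypotheses `h1` and `h2` are the two
lower bounds on n, and `h3` says that the components fit into the graph. -/
theorem large_barrier_bound {δ d r c : ℤ} (hd : 0 ≤ d) (hδ : d + 2 ≤ δ) (hr : 1 ≤ r)
    (h1 : 3 * δ + 4 * d + 2 ≤ c) (h2 : δ * (d ^ 2 + 1) - d - 3 ≤ c) (h3 : δ + 2 * r ≤ c) :
    (δ + r) * (d + r + 1) * 1 * (δ + r + r) < r * (c + 1) * (c + 1 - 1) := by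
  have main : (δ + r) * (d + r + 1) < r * (c + 1) →
      (δ + r) * (d + r + 1) * 1 * (δ + r + r) < r * (c + 1) * (c + 1 - 1) := by
    intro h
    have hp : 0 < c := by linarith
    have : (δ + r) * (d + r + 1) * (δ + 2 * r) ≤ (δ + r) * (d + r + 1) * c :=
      mul_le_mul_of_nonneg_left h3 (mul_nonneg (by linarith) (by linarith))
    nlinarith
  rcases le_or_gt (d + 1) r with hrd | hrd
  · apply main
    have : 2 * (r + δ + 2 * d + 1) ≤ 2 * (c - δ) := by linarith
    nlinarith
  · rcases le_or_gt 3 d with h3d | h3d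
    · apply main
      have hc : 0 ≤ c - δ - (δ * d ^ 2 - d - 3) := by nlinarith
      have hk : δ * (d + 1) + 2 * d < δ * d ^ 2 - d - 3 := by
        have : 5 ≤ d ^ 2 - d - 1 := by nlinarith
        nlinarith
      have e1 : r * (δ * d ^ 2 - d - 3) ≤ r * (c - δ) := by nlinarith
      have e2 : (r - 1) * (δ * (d + 1) + 2 * d) ≥ 0 := by
        apply mul_nonneg <;> nlinarith
      have e3 : r * (δ * (d + 1) + 2 * d) < r * (δ * d ^ 2 - d - 3) :=
        mul_lt_mul_of_pos_left hk (by linarith)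
      nlinarith
    -- The premise of `main` can fail here (d = 2, r = 1, δ = 7, c = 31), so the full product is
    -- compared with (c + 1)c.
    · have hcc : (3 * δ + 4 * d + 3) * (3 * δ + 4 * d + 2) ≤ (c + 1) * c :=
        mul_le_mul (by linarith) (by linarith) (by linarith) (by linarith)
      obtain ⟨rfl, rfl⟩ | ⟨rfl, rfl⟩ | ⟨rfl, rfl⟩ :
        (d = 1 ∧ r = 1) ∨ (d = 2 ∧ r = 1) ∨ (d = 2 ∧ r = 2) := by omega
      all_goals nlinarith

/-- Case s = δ - r > 2k: here a = r + 1, Q = d - r + 1 and u = Qa - d - 1 = (d - r)r. Since d - 1 ≤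
u ≤ d²/4, dividing by u leaves about δ(4δ + d²) on the left, which the cubic bound on n beats. -/
theorem small_barrier_bound {δ d r c : ℤ} (hδ : d + 2 ≤ δ) (hr : 1 ≤ r) (hrd : r < d)
    (h1 : 3 * δ + 4 * d + 2 ≤ c) (h2 : δ * (d ^ 2 + 1) - d - 3 ≤ c) :
    (δ - r) * (d - r + 1) * (r + 1) * (δ - r + (d - r) * r) <
      (d - r) * r * (c + 1) * (c + 1 - (r + 1)) := by
  have hu : d - 1 ≤ (d - r) * r := by nlinarith
  have hu' : 4 * ((d - r) * r) ≤ d ^ 2 := by nlinarith [sq_nonneg (d - 2 * r)]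
  have hQa : (d - r + 1) * (r + 1) = (d - r) * r + d + 1 := by ring
  rw [mul_assoc (δ - r), hQa]
  generalize (d - r) * r = u at *
  have e1 : u + d + 1 ≤ 4 * u := by linarith
  have hu0 : 1 ≤ u := by linarith
  have e2 : (δ - r) * (δ - r + u) ≤ δ * (δ + u) :=
    mul_le_mul (by linarith) (by linarith) (by linarith) (by linarith)
  have e3 : (δ - r) * (u + d + 1) * (δ - r + u) ≤ 4 * u * (δ * (δ + u)) := by
    have : (u + d + 1) * ((δ - r) * (δ - r + u)) ≤ 4 * u * (δ * (δ + u)) :=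
      mul_le_mul e1 e2 (mul_nonneg (by linarith) (by linarith)) (by linarith)
    linarith
  have e4 : 4 * (δ * (δ + u)) ≤ δ * (4 * δ + d ^ 2) := by nlinarith
  have e5 : δ * (4 * δ + d ^ 2) < (c + 1) * (c + 1 - (r + 1)) := by
    have f1 : (δ * (d ^ 2 + 1) - d - 2) * (3 * δ) ≤ (c + 1) * (c + 1 - (r + 1)) :=
      mul_le_mul (by linarith) (by linarith) (by linarith) (by linarith)
    have f2 : 4 * δ + d ^ 2 < (δ * (d ^ 2 + 1) - d - 2) * 3 := by nlinarith
    nlinarith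
  nlinarith

/-- Case s = 2k, where u = 0: the right side vanishes at ε = 0, so the cubic equation for ε is
indispensable. -/
theorem clique_barrier_bound {δ d c ε : ℝ} (hd : 0 < d) (hδ : d ≤ δ) (hε : 0 < ε) (hc : δ ≤ c)
    (heq : ε * (c + ε + 1) * (c + ε) = δ * (d + 1) * (δ + ε)) :
    (δ - d) * 1 * (d + 1) * (δ - d + 0 + ε) <
      (0 + ε) * (c + ε + 1) * (c + ε + 1 - (d + 1)) := by
  have hθ : 0 < c + ε := by linarith
  refine lt_of_mul_lt_mul_right (a := c + ε) ?_ hθ.le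
  have h1 : (δ - d) * (c + ε) ≤ δ * (c + ε - d) := by nlinarith
  have h0 : 0 < δ * (c + ε - d) := mul_pos (by linarith) (by linarith)
  have h2 : (δ - d) * (c + ε) * (δ - d + ε) < δ * (c + ε - d) * (δ + ε) :=
    lt_of_le_of_lt (mul_le_mul_of_nonneg_right h1 (by linarith))
      (mul_lt_mul_of_pos_left (by linarith) h0)
  have h3 := mul_lt_mul_of_pos_left h2 (show 0 < d + 1 by linarith)
  calc _ = (d + 1) * ((δ - d) * (c + ε) * (δ - d + ε)) := by ring
    _ < _ := h3
    _ = δ * (d + 1) * (δ + ε) * (c + ε - d) := by ring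
    _ = _ := by rw [← heq]; ring

/-- The cubic is the characteristic equation of the three-part quotient of the extremal graph at c +
ε; it changes sign on [0, δ]. -/
theorem exists_excess {δ d c : ℝ} (hd : 0 ≤ d) (hδ : d + 2 ≤ δ) (hc : δ ≤ c) :
    ∃ ε, 0 < ε ∧ ε * (c + ε + 1) * (c + ε) = δ * (d + 1) * (δ + ε) := by
  let p : ℝ → ℝ := fun ε => ε * (c + ε + 1) * (c + ε) - δ * (d + 1) * (δ + ε)
  have h0 : p 0 < 0 := by
    have : 0 < δ * (d + 1) * δ := by have : 0 < δ := by linarith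
                                     positivity
    simp only [p]
    linarith
  have h1 : 0 ≤ p δ := by
    have e1 : (d + 1) * (2 * δ) ≤ (c + δ + 1) * (c + δ) :=
      mul_le_mul (by linarith) (by linarith) (by linarith) (by linarith)
    have := mul_le_mul_of_nonneg_left e1 (show 0 ≤ δ by linarith)
    simp only [p]
    linarith
  have hcont : ContinuousOn p (Set.Icc 0 δ) := by fun_prop
  obtain ⟨ε, hε, hp⟩ := intermediate_value_Icc (by linarith : (0 : ℝ) ≤ δ) hcont
    ⟨h0.le, h1⟩
  refine ⟨ε, lt_of_le_of_ne hε.1 ?_, sub_eq_zero.1 hp⟩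
  rintro rfl
  exact h0.ne hp

/-! ### The extremal graph and its recognition from a barrier. -/

namespace SimpleGraph

/-- The three parts of the vertex set of `extremalGraph n k δ`. -/
def joinPart {A B C : Type*} : A ⊕ (B ⊕ C) → Fin 3
  | .inl _ => 0
  | .inr (.inl _) => 1
  | .inr (.inr _) => 2

theorem extremalGraph_adj {n k δ : ℕ}
    (a b : Fin δ ⊕ (Fin (n - 2 * δ + 2 * k - 1) ⊕ Fin (δ - 2 * k + 1))) :
    (extremalGraph n k δ).Adj a b ↔ a ≠ b ∧
      (joinPart a = 0 ∨ joinPart b = 0 ∨ joinPart a = 1 ∧ joinPart b = 1) := by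
  rcases a with a | a | a <;> rcases b with b | b | b <;>
    simp [extremalGraph, joinGraph, joinPart]

theorem card_joinPart {A B C : Type*} [Fintype A] [Fintype B] [Fintype C] (i : Fin 3) :
    #{x : A ⊕ (B ⊕ C) | joinPart x = i} =
      ![Fintype.card A, Fintype.card B, Fintype.card C] i := by
  rw [card_filter, Fintype.sum_sum_type, Fintype.sum_sum_type]
  fin_cases i <;> simp [joinPart]

theorem nonempty_iso_extremalGraph {V : Type*} [Fintype V] {G : SimpleGraph V} {n k δ : ℕ}
    {p : V → Fin 3} (hp : ∀ v w, G.Adj v w ↔ v ≠ w ∧ (p v = 0 ∨ p w = 0 ∨ p v = 1 ∧ p w = 1))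
    (hcard : ∀ i, #{v | p v = i} = ![δ, n - 2 * δ + 2 * k - 1, δ - 2 * k + 1] i) :
    Nonempty (G ≃g extremalGraph n k δ) := by
  have hc : ∀ i, Nonempty ({v // p v = i} ≃
      {x : Fin δ ⊕ (Fin (n - 2 * δ + 2 * k - 1) ⊕ Fin (δ - 2 * k + 1)) // joinPart x = i}) := by
    intro i
    refine ⟨Fintype.equivOfCardEq ?_⟩
    rw [Fintype.card_subtype, Fintype.card_subtype, hcard, card_joinPart]
    simp
  let g := fun i => (hc i).some
  let e := ((Equiv.sigmaFiberEquiv p).symm.trans (Equiv.sigmaCongrRight g)).trans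
    (Equiv.sigmaFiberEquiv joinPart)
  have he : ∀ v, joinPart (e v) = p v := fun v => (g (p v) ⟨v, rfl⟩).2
  refine ⟨⟨e, ?_⟩⟩
  intro v w
  rw [extremalGraph_adj, he, he, hp, e.injective.ne_iff]

theorem not_isExtendable_of_iso_extremalGraph {V : Type*} [Fintype V] {G : SimpleGraph V}
    {n k δ : ℕ} (hδ : 2 * k ≤ δ) (e : G ≃g extremalGraph n k δ) : ¬ G.IsExtendable k := by
  classical
  have hc : ∀ i, #{v | joinPart (e v) = i} = ![δ, n - 2 * δ + 2 * k - 1, δ - 2 * k + 1] i := by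
    intro i
    have := card_joinPart (A := Fin δ) (B := Fin (n - 2 * δ + 2 * k - 1))
      (C := Fin (δ - 2 * k + 1)) i
    simp only [Fintype.card_fin] at this
    rw [← this]
    exact card_equiv e.toEquiv (by simp)
  have hadj : ∀ v w, G.Adj v w ↔ _ := fun v w => e.map_adj_iff.symm.trans (extremalGraph_adj _ _)
  have h0 := hc 0
  have h2 := hc 2
  simp only [Matrix.cons_val] at h0 h2
  refine not_isExtendable_of_isIndepSet (D := {v | joinPart (e v) = 0})
    (I := {v | joinPart (e v) = 2}) ?_ ?_ (by omega) ?_ (by omega)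
  · intro u hu v _ huv
    exact (hadj u v).2 ⟨e.injective.ne huv, Or.inl ((mem_filter_univ u).1 hu)⟩
  · intro u hu v huv
    have hu' := (mem_filter_univ u).1 hu
    have := ((hadj u v).1 huv).2
    rw [hu'] at this
    simpa using this
  · rw [Finset.disjoint_left]
    intro v hv hv'
    rw [mem_filter_univ] at hv hv'
    rw [hv] at hv'
    cases hv'

/-- The weights 1, δ / (δ + ε), δ / θ with θ = N + δ - 1 + ε satisfy the rows of the second and
third parts identically; the row of the first part is `heq`. That θ is the largest eigenvalue is not
needed. -/
theorem le_adjSpectralRadius_extremalGraph {n k δ : ℕ} {d N ε : ℝ} (hδ0 : 0 < δ)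
    (hd : ((δ - 2 * k + 1 : ℕ) : ℝ) = d + 1) (hN : ((n - 2 * δ + 2 * k - 1 : ℕ) : ℝ) = N)
    (hε : 0 < ε) (hθ : 0 < N + δ - 1 + ε)
    (heq : ε * (N + δ - 1 + ε + 1) * (N + δ - 1 + ε) = δ * (d + 1) * (δ + ε)) :
    N + δ - 1 + ε ≤ (extremalGraph n k δ).adjSpectralRadius := by
  classical
  have hδ : (0 : ℝ) < δ := by exact_mod_cast hδ0
  let X : Fin 3 → ℝ := ![1, δ / (δ + ε), δ / (N + δ - 1 + ε)]
  refine le_adjSpectralRadius _ (x := fun v => X (joinPart v)) (fun h => ?_) fun v => ?_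
  · have := congrFun h (Sum.inl ⟨0, hδ0⟩)
    simp [X, joinPart] at this
  -- The part condition holds for the pair (v, v) unless v is in the independent part, so its own
  -- weight is subtracted only outside that part.
  · have hsplit : ∑ w ∈ (extremalGraph n k δ).neighborFinset v, X (joinPart w) =
        ∑ w : Fin δ ⊕ (Fin (n - 2 * δ + 2 * k - 1) ⊕ Fin (δ - 2 * k + 1)), (if joinPart v = 0 ∨ joinPart w = 0 ∨ joinPart v = 1 ∧ joinPart w = 1 then
          X (joinPart w) else 0) - if joinPart v = 2 then 0 else X (joinPart v) := by
      rw [neighborFinset_eq_filter, sum_filter, eq_sub_iff_add_eq,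
        ← sum_erase_add _ _ (mem_univ v), ← sum_erase_add univ _ (mem_univ v), if_neg (by simp),
        add_zero]
      refine congrArg₂ _ (sum_congr rfl fun w hw => ?_) ?_
      · rw [extremalGraph_adj]
        simp only [(ne_of_mem_erase hw).symm, ne_eq, not_false_eq_true, true_and]
      · rcases v with v | v | v <;> simp [joinPart]
    rw [hsplit, Fintype.sum_sum_type, Fintype.sum_sum_type]
    have hne : δ + ε ≠ 0 := by positivity
    rcases v with v | v | v
    · simp [joinPart, X, hd, hN]
      field_simp
      linear_combination -heq
    · simp [joinPart, X, hN]
      field_simp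
      ring
    · simp [joinPart, X]
      field_simp

/-- Here c + 1 - u is the order of the clique formed by S and the largest component in the convex
extreme, and u is its deficit against the K_{N+δ} of the extremal graph. A strict `hle` contradicts
the first conclusion. -/
theorem Connected.barrier_of_le_eigenvalue {V K : Type*} [Fintype V] [DecidableEq V]
    [DecidableEq K] [Fintype K] {G : SimpleGraph V} [DecidableRel G.Adj] {f : V → Option K}
    (hG : G.Connected) (hadj : ∀ v w c d, G.Adj v w → f v = some c → f w = some d → c = d)
    {s Q a u c ε μ : ℝ} (hs : s = #{w | f w = none}) (hs0 : 0 < s)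
    (hQ : Q + 1 ≤ Fintype.card K) (ha : 0 < a) (hm : ∀ i, a ≤ #{w | f w = some i})
    (hcard : (Fintype.card V : ℝ) = c + 1 - u + Q * a) (hu : 0 ≤ u) (hε : 0 < ε)
    (hle : s * Q * a * (s + u + ε) ≤ (u + ε) * (c + ε + 1) * (c + ε + 1 - a))
    {x : V → ℝ} (hx : x ≠ 0) (hev : ∀ v, ∑ w ∈ G.neighborFinset v, x w = μ * x v)
    (hμ : c + ε ≤ μ) :
    s * Q * a * (s + u + ε) = (u + ε) * (c + ε + 1) * (c + ε + 1 - a) ∧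
      (Fintype.card K : ℝ) = Q + 1 ∧
      (∀ i, (#{w | f w = some i} : ℝ) = a ∨ (#{w | f w = some i} : ℝ) = c + 1 - s - u) ∧
      ∀ v w, v ≠ w → (f v = none ∨ f w = none ∨ f v = f w) → G.Adj v w := by
  have htot : s + ∑ i, (#{w | f w = some i} : ℝ) = Fintype.card V := by
    have := card_eq_sum_card_fiberwise (f := f) (s := univ) (t := univ)
      fun _ _ => mem_coe.2 (mem_univ _)
    rw [Fintype.sum_option, card_univ] at this
    rw [hs, this]
    push_cast
    rfl
  have hsum : ∑ i, (#{w | f w = some i} : ℝ) = (c + 1 - s - u) + Q * a := by linarith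
  have haM : a ≤ c + 1 - s - u := by
    have h1 : ∑ _i : K, a ≤ ∑ i, (#{w | f w = some i} : ℝ) := sum_le_sum fun i _ => hm i
    rw [sum_const, card_univ, nsmul_eq_mul] at h1
    nlinarith
  have hs1 : 1 ≤ s := by
    rw [hs] at hs0 ⊢
    exact_mod_cast hs0
  have hMθ : 0 < c + ε - (c + 1 - s - u) + 1 := by linarith
  obtain ⟨hmM, hbound, hequal⟩ := sum_div_le_of_parts (θ := c + ε) ha haM hMθ hm hsum hQ
  have hpos : 0 < (s + u + ε) * (c + ε + 1 - a) := by
    apply mul_pos <;> linarith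
  have hid := sub_quotient_bound_eq (s := s) (Q := Q) (a := a) (u := u) (c := c) (ε := ε)
    (by linarith) (by linarith)
  have hnn := div_nonneg (sub_nonneg.2 hle) hpos.le
  have hmul := mul_le_mul_of_nonneg_left hbound hs0.le
  obtain ⟨heq, hall⟩ := hG.adj_of_barrier_of_le_eigenvalue hadj (θ := c + ε)
    (m := fun i => (#{w | f w = some i} : ℝ)) hs hs0 (fun _ => rfl) (by linarith)
    (fun i => by linarith [hmM i]) (by linarith) hx hev hμ
  have h0 : ((u + ε) * (c + ε + 1) * (c + ε + 1 - a) - s * Q * a * (s + u + ε)) /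
      ((s + u + ε) * (c + ε + 1 - a)) = 0 := by linarith
  have h1 := (div_eq_zero_iff.1 h0).resolve_right hpos.ne'
  obtain ⟨hK, hparts⟩ := hequal (mul_left_cancel₀ hs0.ne' (by linarith))
  exact ⟨by linarith, hK, hparts, hall⟩

/-- Among components of sizes `1` and `N`, exactly one has size `N`. -/
theorem exists_unique_large_part {K : Type*} [Fintype K] [DecidableEq K] {m : K → ℕ} {N t : ℕ}
    (hN : 1 < N) (hcard : Fintype.card K = t + 1) (hsum : ∑ i, m i = N + t)
    (hm : ∀ i, m i = 1 ∨ m i = N) : ∃ i₀, m i₀ = N ∧ ∀ i, i ≠ i₀ → m i = 1 := by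
  have hex : ∃ i₀, m i₀ = N := by
    by_contra! h
    have : ∑ i, m i = ∑ _i : K, 1 := sum_congr rfl fun i _ => (hm i).resolve_right (h i)
    rw [sum_const, card_univ, smul_eq_mul] at this
    omega
  obtain ⟨i₀, hi₀⟩ := hex
  refine ⟨i₀, hi₀, fun i hi => ?_⟩
  have h1 := sum_erase_add univ m (mem_univ i₀)
  have h2 : ∑ _i ∈ univ.erase i₀, 1 = t := by
    rw [sum_const, card_erase_of_mem (mem_univ _), card_univ, hcard, smul_eq_mul]
    omega
  have h3 : ∀ i ∈ univ.erase i₀, 1 ≤ m i := fun i _ => by rcases hm i with h | h <;> omega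
  exact ((sum_eq_sum_iff_of_le h3).1 (by omega) i (mem_erase.2 ⟨hi, mem_univ i⟩)).symm

theorem nonempty_iso_extremalGraph_of_barrier {V K : Type*} [Fintype V] [DecidableEq V]
    [DecidableEq K] [Fintype K] {G : SimpleGraph V} {f : V → Option K} {n k δ : ℕ}
    (hf : ∀ v w, G.Adj v w ↔ v ≠ w ∧ (f v = none ∨ f w = none ∨ f v = f w))
    (hnone : #{v | f v = none} = δ) (hK : Fintype.card K = δ - 2 * k + 2)
    (hV : Fintype.card V = δ + (n - 2 * δ + 2 * k - 1) + (δ - 2 * k + 1))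
    (hN : 1 < n - 2 * δ + 2 * k - 1)
    (hm : ∀ i, #{v | f v = some i} = 1 ∨ #{v | f v = some i} = n - 2 * δ + 2 * k - 1) :
    Nonempty (G ≃g extremalGraph n k δ) := by
  have htot := card_eq_sum_card_fiberwise (f := f) (s := univ) (t := univ)
    fun _ _ => mem_coe.2 (mem_univ _)
  rw [Fintype.sum_option, card_univ, hnone] at htot
  obtain ⟨i₀, hi₀, hone⟩ := exists_unique_large_part (m := fun i => #{v | f v = some i})
    (t := δ - 2 * k + 1) hN (by omega) (by omega) hm
  let q : Option K → Fin 3 := fun o => if o = none then 0 else if o = some i₀ then 1 else 2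
  have hq0 : ∀ o, q o = 0 ↔ o = none := fun o => by
    simp only [q]; split_ifs <;> simp_all
  have hq1 : ∀ o, q o = 1 ↔ o = some i₀ := fun o => by
    simp only [q]; split_ifs <;> simp_all
  have h0 : #{v | q (f v) = 0} = δ := by simp only [hq0, hnone]
  have h1 : #{v | q (f v) = 1} = n - 2 * δ + 2 * k - 1 := by simp only [hq1, hi₀]
  have hp := card_eq_sum_card_fiberwise (f := fun v => q (f v)) (s := univ) (t := univ)
    fun _ _ => mem_coe.2 (mem_univ _)
  rw [Fin.sum_univ_three, card_univ, h0, h1] at hp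
  refine nonempty_iso_extremalGraph (p := fun v => q (f v)) (fun v w => ?_) fun i => ?_
  · rw [hf, hq0, hq0, hq1, hq1]
    refine and_congr_right fun hvw => or_congr_right' fun hv => or_congr_right' fun hw => ?_
    constructor
    · intro h
      obtain ⟨i, hi⟩ := Option.ne_none_iff_exists'.1 hv
      have hi' := h ▸ hi
      have : i = i₀ := by
        -- Every fibre other than that of `i₀` is a singleton, so it cannot contain both v and w.
        by_contra hne
        exact hvw (card_le_one.1 (hone i hne).le v (by simpa using hi) w (by simpa using hi'))
      subst this
      exact ⟨hi, hi'⟩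
    · rintro ⟨h, h'⟩
      rw [h, h']
  · fin_cases i
    · exact h0
    · exact h1
    · change #{v | q (f v) = 2} = δ - 2 * k + 1
      omega

/-! ### Assembly: the cases s < δ, s = δ and s > δ. -/

theorem exists_isMatching_of_two_mul_le_minDegree {V : Type*} [Fintype V] [Nonempty V]
    (G : SimpleGraph V) [DecidableRel G.Adj] {k : ℕ} (h : 2 * k ≤ G.minDegree) :
    ∃ M : G.Subgraph, M.IsMatching ∧ M.edgeSet.encard = k := by
  classical
  obtain ⟨M, hM, hMk, -⟩ := G.exists_isMatching_of_forall_exists_adj Set.univ k (by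
    intro T _ hT
    have hV : G.minDegree < Fintype.card V :=
      (G.minDegree_le_degree (Classical.arbitrary V)).trans_lt (G.degree_lt_card_verts _)
    obtain ⟨u, hu⟩ : ∃ u, u ∉ T := by
      by_contra! hall
      rw [Set.eq_univ_of_forall hall, Set.ncard_univ, Nat.card_eq_fintype_card] at hT
      omega
    obtain ⟨v, hv, hvT⟩ : ∃ v ∈ (G.neighborFinset u : Set V), v ∉ T := by
      refine Set.exists_mem_notMem_of_ncard_lt_ncard ?_
      rw [Set.ncard_coe_finset, card_neighborFinset_eq_degree]
      have := G.minDegree_le_degree u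
      omega
    exact ⟨u, ⟨trivial, hu⟩, v, ⟨trivial, hvT⟩, (G.mem_neighborFinset u v).1 hv⟩)
  refine ⟨M, hM, ?_⟩
  rw [← hMk]
  exact (Set.Finite.cast_ncard_eq (Set.toFinite _)).symm

theorem nonempty_iso_extremalGraph_of_not_isExtendable {V : Type*} [Fintype V]
    (G : SimpleGraph V) [DecidableRel G.Adj] {n k δ : ℕ} (hconn : G.Connected)
    (hcard : Fintype.card V = n) (heven : Even n) (hmin : G.minDegree = δ) (hk : 1 ≤ k)
    (hδ : 2 * k ≤ δ) (hn1 : 8 * (δ : ℤ) - 10 * k + 4 ≤ n)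
    (hn2 : (δ : ℤ) * (δ - 2 * k) ^ 2 + δ - 1 ≤ n)
    (hρ : (extremalGraph n k δ).adjSpectralRadius ≤ G.adjSpectralRadius)
    (hext : ¬ G.IsExtendable k) : Nonempty (G ≃g extremalGraph n k δ) := by
  classical
  have := hconn.nonempty
  obtain ⟨M, hM, hMk, hno⟩ : ∃ M : G.Subgraph, M.IsMatching ∧ M.edgeSet.encard = k ∧
      ∀ P : G.Subgraph, P.IsPerfectMatching → ¬ M ≤ P := by
    by_contra! h
    exact hext ⟨G.exists_isMatching_of_two_mul_le_minDegree (by omega), h⟩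
  have hMk' : M.edgeSet.ncard = k := by rw [Set.ncard, hMk]; rfl
  obtain ⟨K, _, _, f, hsurj, hadj, hs1, hs2⟩ := exists_barrier (hcard ▸ heven) hM hno
  rw [hMk'] at hs1 hs2
  obtain ⟨d, rfl⟩ := Nat.exists_eq_add_of_le hδ
  set δ := 2 * k + d with hδd
  have hd : (δ : ℤ) - 2 * k = d := by rw [hδd]; push_cast; ring
  rw [hd] at hn2
  -- This is N + δ - 1; `hc1` and `hc2` are the two lower bounds on n in terms of c.
  set c : ℤ := n - d - 2 with hc
  have hc1 : 3 * (δ : ℤ) + 4 * d + 2 ≤ c := by omega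
  have hc2 : (δ : ℤ) * ((d : ℤ) ^ 2 + 1) - d - 3 ≤ c := by
    rw [hc]
    linarith
  have hc1R : 3 * (δ : ℝ) + 4 * d + 2 ≤ c := by exact_mod_cast hc1
  have hδR : (δ : ℝ) = 2 * k + d := by rw [hδd]; push_cast; ring
  have hkR : (1 : ℝ) ≤ k := by exact_mod_cast hk
  have hd0 : (0 : ℝ) ≤ d := d.cast_nonneg
  have hcR : (c : ℝ) = n - d - 2 := by rw [hc]; push_cast; ring
  obtain ⟨ε, hε, heq⟩ := exists_excess (δ := (δ : ℝ)) (d := d) (c := c) hd0 (by linarith)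
    (by linarith)
  have hNδ : ((n - 2 * δ + 2 * k - 1 : ℕ) : ℝ) + δ - 1 = c := by
    have : ((n - 2 * δ + 2 * k - 1 : ℕ) : ℤ) + δ - 1 = c := by omega
    exact_mod_cast this
  have hθ : (c : ℝ) + ε ≤ (extremalGraph n k δ).adjSpectralRadius := by
    have h := le_adjSpectralRadius_extremalGraph (n := n) (k := k) (δ := δ) (d := d) (ε := ε)
      (by omega) (by rw [show δ - 2 * k + 1 = d + 1 by omega]; push_cast; ring) rfl hε
      (by rw [hNδ]; linarith) (by rw [hNδ]; linarith)
    rwa [hNδ] at h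
  obtain ⟨μ, hμ, x, hx, hev⟩ := exists_eigenvector_of_le_adjSpectralRadius G
    (by linarith : (0 : ℝ) < c + ε) (hθ.trans hρ)
  have hone : ∀ i, 1 ≤ #{w | f w = some i} := fun i => by
    obtain ⟨v, hv⟩ := hsurj i
    exact card_pos.2 ⟨v, by simpa using hv⟩
  have hsize : ∀ i, δ + 1 ≤ #{w | f w = none} + #{w | f w = some i} := fun i => by
    obtain ⟨v, hv⟩ := hsurj i
    have := degree_lt_of_barrier hadj hv
    have := G.minDegree_le_degree v
    omega
  have htot : #{w | f w = none} + Fintype.card K ≤ n := by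
    have h1 := card_eq_sum_card_fiberwise (f := f) (s := univ) (t := univ)
      fun _ _ => mem_coe.2 (mem_univ _)
    have h2 : ∑ _i : K, 1 ≤ ∑ i, #{w | f w = some i} := sum_le_sum fun i _ => hone i
    rw [Fintype.sum_option, card_univ, hcard] at h1
    rw [sum_const, card_univ, smul_eq_mul, mul_one] at h2
    omega
  obtain ⟨s, hs⟩ : ∃ s, #{w | f w = none} = s := ⟨_, rfl⟩
  have hVR : (Fintype.card V : ℝ) = c + d + 2 := by rw [hcard, hcR]; ring
  have hs2R : (s : ℝ) + 2 ≤ Fintype.card K + 2 * k := by rw [hs] at hs2; exact_mod_cast hs2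
  rw [hs] at hs1 hs2 htot
  rcases lt_trichotomy s δ with hlt | heqs | hgt
  -- The minimum degree forces every component to have at least r + 1 vertices, and s ≥ 2k gives r ≤
  -- d.
  · obtain ⟨r, hr⟩ : ∃ r, δ = s + r := ⟨δ - s, by omega⟩
    have hr1 : 1 ≤ r := by omega
    have hrd : r ≤ d := by omega
    have hsR : (s : ℝ) = δ - r := by rw [hr]; push_cast; ring
    have hr1R : (1 : ℝ) ≤ r := by exact_mod_cast hr1
    have hrdR : (r : ℝ) ≤ d := by exact_mod_cast hrd
    have hstrict : (s : ℝ) * (d - r + 1) * (r + 1) * (s + (d - r) * r + ε) <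
        ((d - r) * r + ε) * (c + ε + 1) * (c + ε + 1 - (r + 1)) := by
      rcases hrd.lt_or_eq with hrd' | rfl
      · have hrdR' : (r : ℝ) < d := by exact_mod_cast hrd'
        have hb := small_barrier_bound (δ := δ) (d := d) (r := r) (c := c) (by omega)
          (by omega) (by omega) hc1 hc2
        have hb' : ((δ : ℝ) - r) * (d - r + 1) * (r + 1) * (δ - r + (d - r) * r) <
          (d - r) * r * (c + 1) * (c + 1 - (r + 1)) := by exact_mod_cast hb
        rw [← hsR] at hb'
        refine cleared_quotient_bound_of_excess_zero hε.le (mul_pos (by linarith) (by linarith)) ?_ s.cast_nonneg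
          (by linarith) (by linarith) hb'
        exact mul_nonneg (mul_nonneg s.cast_nonneg (by linarith)) (by linarith)
      · have := clique_barrier_bound (δ := δ) (d := r) (c := c) (ε := ε) (by linarith)
          (by linarith) hε (by linarith) heq
        rw [hsR]
        simpa using this
    have h := hconn.barrier_of_le_eigenvalue hadj (s := s) (Q := d - r + 1) (a := r + 1)
      (u := (d - r) * r) (c := c) (ε := ε) (by rw [hs]) (by linarith) (by linarith)
      (by linarith)
      (fun i => by
        have := hsize i
        rw [hs] at this
        exact_mod_cast (by omega : r + 1 ≤ #{w | f w = some i}))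
      (by rw [hVR]; ring) (mul_nonneg (by linarith) (by linarith)) hε hstrict.le
      hx hev hμ
    exact absurd h.1 hstrict.ne
  · subst heqs
    -- With a = 1 and u = 0 the cleared inequality is exactly the cubic defining ε.
    have hE : (δ : ℝ) * (d + 1) * 1 * (δ + 0 + ε) = (0 + ε) * (c + ε + 1) * (c + ε + 1 - 1) := by
      linear_combination -heq
    obtain ⟨-, hK, hparts, hall⟩ := hconn.barrier_of_le_eigenvalue hadj (s := δ) (Q := d + 1)
      (a := 1) (u := 0) (c := c) (ε := ε) (by rw [hs]) (by linarith) (by linarith)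
      one_pos (fun i => by exact_mod_cast hone i)
      (by rw [hVR]; ring) le_rfl hε hE.le hx hev hμ
    have hK' : Fintype.card K = d + 1 + 1 := by exact_mod_cast hK
    refine nonempty_iso_extremalGraph_of_barrier (f := f) (fun v w => ⟨fun h => ?_, fun h =>
      hall v w h.1 h.2⟩) hs (by omega) (by omega) (by omega) fun i => ?_
    · have := neighborFinset_subset_barrierNeighbors hadj v ((G.mem_neighborFinset v w).2 h)
      exact ⟨h.ne, (mem_filter.1 this).2.2⟩
    · refine (hparts i).imp (fun h => by exact_mod_cast h) fun h => ?_
      have : (#{w | f w = some i} : ℝ) = ((n - 2 * δ + 2 * k - 1 : ℕ) : ℝ) := by linarith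
      exact_mod_cast this
  · obtain ⟨r, hr⟩ : ∃ r, s = δ + r := ⟨s - δ, by omega⟩
    have hr1 : 1 ≤ r := by omega
    have hsR : (s : ℝ) = δ + r := by rw [hr]; push_cast; ring
    have hr1R : (1 : ℝ) ≤ r := by exact_mod_cast hr1
    have hb := large_barrier_bound (δ := δ) (d := d) (r := r) (c := c) (by omega) (by omega)
      (by omega) hc1 hc2 (by omega)
    have hb' : ((δ : ℝ) + r) * (d + r + 1) * 1 * (δ + r + r) < r * (c + 1) * (c + 1 - 1) := by
      exact_mod_cast hb
    rw [← hsR] at hb'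
    have hstrict := cleared_quotient_bound_of_excess_zero (s := (s : ℝ)) hε.le (by linarith)
      (mul_nonneg (mul_nonneg s.cast_nonneg (by linarith)) zero_le_one) s.cast_nonneg
      (by linarith) (by linarith) hb'
    have h := hconn.barrier_of_le_eigenvalue hadj (s := s) (Q := d + r + 1) (a := 1)
      (u := r) (c := c) (ε := ε) (by rw [hs]) (by linarith) (by linarith)
      one_pos (fun i => by exact_mod_cast hone i)
      (by rw [hVR]; ring) (by linarith) hε hstrict.le hx hev hμ
    exact absurd h.1 hstrict.ne

end SimpleGraph

theorem theorem1p1 {V : Type*} [Fintype V] (G : SimpleGraph V) [DecidableRel G.Adj]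
    (n k δ : ℕ) (hconn : G.Connected) (hcard : Fintype.card V = n) (heven : Even n)
    (hmin : G.minDegree = δ) (hk : 1 ≤ k) (hδ : 2 * k ≤ δ)
    (hn : max (8 * (δ : ℤ) - 10 * (k : ℤ) + 4)
      ((δ : ℤ) * ((δ : ℤ) - 2 * (k : ℤ)) ^ 2 + (δ : ℤ) - 1) ≤ (n : ℤ))
    (hρ : (SimpleGraph.extremalGraph n k δ).adjSpectralRadius ≤ G.adjSpectralRadius) :
    G.IsExtendable k ↔ ¬ Nonempty (G ≃g SimpleGraph.extremalGraph n k δ) := by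
  refine ⟨fun h ⟨e⟩ => SimpleGraph.not_isExtendable_of_iso_extremalGraph hδ e h, fun h => ?_⟩
  by_contra hext
  exact h (G.nonempty_iso_extremalGraph_of_not_isExtendable hconn hcard heven hmin hk hδ
    ((le_max_left _ _).trans hn) ((le_max_right _ _).trans hn) hρ hext)
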